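/- A complete non-ambiguous tree (CNAT) is a set of dotted cells in an $m \times n$ rectangular grid ($m, n \geq 1$; rows numbered from top to bottom, columns from left to right) such that: 1. every row and every column contains at least one dotted cell; 2. aside from the top-left cell, every dotted cell has either a dotted cell above it in the same column, or a dotted cell to its left in the same row, but not both; 3. every dotted cell either has both a dotted cell below it in the same column and a dotted cell to its right in the same row, or has neither of these. A leaf dot of a CNAT is a dotted cell with no dotted cell below it in the same column and none to its right in the same row. An $n$-permutation $\pi = \pi_1 \cdots \pi_n$ is associated with a CNAT $T$ in the $n \times n$ grid if the leaf dots of $T$ are exactly the cells in column $i$ and row $\pi_i$, for $i = 1, \dots, n$. Let $b(n,k)$ be the number of $n$-permutations that are associated with exactly $k$ CNATs. Then, for every integer $n \geq 3$, $$b(n,3) = (n-3) \cdot 2^{n-4},$$ where the right-hand side is a rational number that equals $0$ when $n = 3$. -/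

import Mathlib

namespace CNAT

/-- A filling of an `m × n` rectangular grid: the finite set of its dotted cells. A cell is a pair
`(row, column)`; rows are numbered from top to bottom and columns from left to right, from `0`. -/
abbrev Filling (m n : ℕ) := Finset (Fin m × Fin n)

variable {m n : ℕ}

/-- There is a dotted cell strictly above the cell `d`, in the same column. -/
def DotAbove (T : Filling m n) (d : Fin m × Fin n) : Prop :=
  ∃ r : Fin m, r < d.1 ∧ (r, d.2) ∈ T

/-- There is a dotted cell strictly below the cell `d`, in the same column. -/
def DotBelow (T : Filling m n) (d : Fin m × Fin n) : Prop :=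
  ∃ r : Fin m, d.1 < r ∧ (r, d.2) ∈ T

/-- There is a dotted cell strictly to the left of the cell `d`, in the same row. -/
def DotLeft (T : Filling m n) (d : Fin m × Fin n) : Prop :=
  ∃ c : Fin n, c < d.2 ∧ (d.1, c) ∈ T

/-- There is a dotted cell strictly to the right of the cell `d`, in the same row. -/
def DotRight (T : Filling m n) (d : Fin m × Fin n) : Prop :=
  ∃ c : Fin n, d.2 < c ∧ (d.1, c) ∈ T

/-- Non-ambiguous trees. -/
structure IsNAT (T : Filling m n) : Prop where
  /-- The grid is not degenerate. -/
  grid_pos : 0 < m ∧ 0 < n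
  /-- Every row contains a dotted cell. -/
  row_nonempty : ∀ r : Fin m, ∃ c : Fin n, (r, c) ∈ T
  /-- Every column contains a dotted cell. -/
  col_nonempty : ∀ c : Fin n, ∃ r : Fin m, (r, c) ∈ T
  /-- Aside from the top-left cell, every dotted cell has either a dotted cell above it in the same
  column, or a dotted cell to its left in the same row, but not both. -/
  unique_parent : ∀ d ∈ T, ¬ ((d.1 : ℕ) = 0 ∧ (d.2 : ℕ) = 0) →
    Xor (DotAbove T d) (DotLeft T d)

/-- Complete non-ambiguous trees: every dot has both a dot below it in the same column and a dot to
its right in the same row, or neither of these. -/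
structure IsCNAT (T : Filling m n) : Prop extends IsNAT T where
  complete : ∀ d ∈ T, (DotBelow T d ∧ DotRight T d) ∨ (¬ DotBelow T d ∧ ¬ DotRight T d)

/-- Leaf dots: no dot below in the same column, and no dot to the right in the same row. -/
def IsLeaf (T : Filling m n) (d : Fin m × Fin n) : Prop :=
  d ∈ T ∧ ¬ DotBelow T d ∧ ¬ DotRight T d

/-- The permutation `π` is associated with `T`: the leaf dots of `T` form the graphical
representation of `π`, whose dots lie in column `c` and row `π c`. -/
def IsAssociated (T : Filling n n) (π : Equiv.Perm (Fin n)) : Prop :=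
  ∀ r c : Fin n, IsLeaf T (r, c) ↔ r = π c

/-- The set of complete non-ambiguous trees whose associated permutation is `π`. -/
def cnatSet (π : Equiv.Perm (Fin n)) : Set (Filling n n) :=
  {T | IsCNAT T ∧ IsAssociated T π}

/-- The number of complete non-ambiguous trees whose associated permutation is `π`. -/
noncomputable def cnat (π : Equiv.Perm (Fin n)) : ℕ := (cnatSet π).ncard

/-- The set `B(n, k)` of `n`-permutations associated with exactly `k` complete non-ambiguous
trees. -/
def B (n k : ℕ) : Set (Equiv.Perm (Fin n)) := {π | cnat π = k}

/-- `b(n, k)` is the cardinality of `B(n, k)`. -/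
noncomputable def b (n k : ℕ) : ℕ := (B n k).ncard

end CNAT

/-! Rows and columns are numbered from 0. CNATs of a fixed `π` are compared by moving a single dot
(`rotate`, `slide`) and are sorted by their dots at `(0,1)`, `(1,0)`, `(1,1)`. When `π 0`, `π 1` and
`π.symm 0` all exceed 1, three of the four classes are equinumerous, and nonempty if any CNAT
exists. The fourth is nonempty if moreover `π.symm 0 > 2` or, by transposition, `π 0 > 2` and
`π.symm 1 > 1`; then `π` has at least 4 CNATs. If `π 1 = 1` instead, the count is even.

Hence an odd count below 4 forces `π 1 = 0`, `π 0 = 1`, or `π 2 = 0`, `π 0 = 2`, `π 1 > 1`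
(`of_odd_cnat_lt_four`). In the first two cases removing that value preserves the count; in the
third the fourth class is empty and the count is three times that of a permutation `τ` with two
points fewer and `τ 0 ≠ 0`. This gives `b_add_three`, whence `b (m+2) 1 = 2^m` and `b (m+4) 3 = 2 *
b (m+3) 3 + 2^m`. -/

namespace CNAT

/-! ### Local description of the CNATs of a permutation -/

/-- A local form of membership in `cnatSet`: the leaf cells are dotted, every dot lies weakly above
the leaf of its column and weakly to the left of the leaf of its row, and every dot other than the
root has a dot above it or to its left, but not both. -/
structure IsCnatOf {m : ℕ} (π : Equiv.Perm (Fin (m + 1))) (T : Filling (m + 1) (m + 1)) :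
    Prop where
  leaf_mem : ∀ c, (π c, c) ∈ T
  le_col : ∀ r c, (r, c) ∈ T → r ≤ π c
  le_row : ∀ r c, (r, c) ∈ T → c ≤ π.symm r
  parent : ∀ r c, (r, c) ∈ T → ¬ (r = 0 ∧ c = 0) →
    ((∃ r' < r, (r', c) ∈ T) ↔ ¬ ∃ c' < c, (r, c') ∈ T)

/-- By completeness the lowest dot of a column and the rightmost dot of a row are leaves, which
gives the bounds. Conversely, a dot that is not a leaf cell has the leaf of its column below it and
the leaf of its row to its right. -/
theorem mem_cnatSet_iff {m : ℕ} {π : Equiv.Perm (Fin (m + 1))} {T : Filling (m + 1) (m + 1)} :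
    T ∈ cnatSet π ↔ IsCnatOf π T := by
  have z : ∀ r c : Fin (m + 1), ((r : ℕ) = 0 ∧ (c : ℕ) = 0) ↔ (r = 0 ∧ c = 0) := by
    intro r c
    rw [Fin.ext_iff, Fin.ext_iff]
    simp
  constructor
  · rintro ⟨hT, hπ⟩
    refine ⟨fun c => ((hπ _ _).2 rfl).1, ?_, ?_, ?_⟩
    · intro r c h
      obtain ⟨s, hs, hmax⟩ := Finset.exists_maximal (s := Finset.univ.filter fun s => (s, c) ∈ T)
        ⟨r, by simpa using h⟩
      simp only [Finset.mem_filter, Finset.mem_univ, true_and] at hs hmax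
      have hb : ¬ DotBelow T (s, c) := by
        rintro ⟨s', hs', hm⟩
        exact absurd (hmax hm hs'.le) (not_le.2 hs')
      have hl : IsLeaf T (s, c) := ⟨hs, by rcases hT.complete _ hs with h | h <;> tauto⟩
      rw [← (hπ _ _).1 hl]
      rcases le_total r s with h' | h'
      · exact h'
      · exact hmax h h'
    · intro r c h
      obtain ⟨s, hs, hmax⟩ := Finset.exists_maximal (s := Finset.univ.filter fun s => (r, s) ∈ T)
        ⟨c, by simpa using h⟩
      simp only [Finset.mem_filter, Finset.mem_univ, true_and] at hs hmax
      have hb : ¬ DotRight T (r, s) := by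
        rintro ⟨s', hs', hm⟩
        exact absurd (hmax hm hs'.le) (not_le.2 hs')
      have hl : IsLeaf T (r, s) := ⟨hs, by rcases hT.complete _ hs with h | h <;> tauto⟩
      rw [(hπ _ _).1 hl, Equiv.symm_apply_apply]
      rcases le_total c s with h' | h'
      · exact h'
      · exact hmax h h'
    · intro r c h h0
      have := hT.unique_parent _ h (by simpa only [z] using h0)
      rw [xor_iff_iff_not] at this
      exact this
  · intro h
    have hbelow : ∀ r c, (r, c) ∈ T → (DotBelow T (r, c) ↔ r ≠ π c) := by
      intro r c hd
      constructor
      · rintro ⟨s, hs, hm⟩ rfl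
        exact absurd (h.le_col _ _ hm) (not_le.2 hs)
      · intro hne
        exact ⟨π c, lt_of_le_of_ne (h.le_col _ _ hd) hne, h.leaf_mem c⟩
    have hright : ∀ r c, (r, c) ∈ T → (DotRight T (r, c) ↔ r ≠ π c) := by
      intro r c hd
      constructor
      · rintro ⟨s, hs, hm⟩ rfl
        have := h.le_row _ _ hm
        rw [Equiv.symm_apply_apply] at this
        exact absurd this (not_le.2 hs)
      · intro hne
        refine ⟨π.symm r, lt_of_le_of_ne (h.le_row _ _ hd) ?_, ?_⟩
        · rintro rfl
          simp at hne
        · simpa using h.leaf_mem (π.symm r)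
    refine ⟨⟨⟨⟨by omega, by omega⟩, ?_, ?_, ?_⟩, ?_⟩, ?_⟩
    · intro r
      exact ⟨π.symm r, by simpa using h.leaf_mem (π.symm r)⟩
    · intro c
      exact ⟨π c, h.leaf_mem c⟩
    · rintro ⟨r, c⟩ hd h0
      rw [xor_iff_iff_not]
      exact h.parent r c hd (by simpa only [z] using h0)
    · rintro ⟨r, c⟩ hd
      rw [hbelow r c hd, hright r c hd]
      tauto
    · intro r c
      constructor
      · rintro ⟨hd, hb, -⟩
        rw [hbelow r c hd] at hb
        tauto
      · rintro rfl
        have hd := h.leaf_mem c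
        exact ⟨hd, by rw [hbelow _ _ hd]; tauto, by rw [hright _ _ hd]; tauto⟩

/-! ### Transposition and one-dot exchanges -/

/-- Reflection of a filling in the main diagonal. -/
def transpose {m : ℕ} (T : Filling m m) : Filling m m := T.map (Equiv.prodComm _ _).toEmbedding

@[simp] theorem mem_transpose {m : ℕ} {T : Filling m m} {r c : Fin m} :
    (r, c) ∈ transpose T ↔ (c, r) ∈ T := by
  simp [transpose]

@[simp] theorem transpose_transpose {m : ℕ} (T : Filling m m) : transpose (transpose T) = T := by
  ext ⟨r, c⟩
  simp

namespace IsCnatOf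

variable {m : ℕ} {π : Equiv.Perm (Fin (m + 1))} {T : Filling (m + 1) (m + 1)}

theorem transpose (h : IsCnatOf π T) : IsCnatOf π.symm (transpose T) where
  leaf_mem c := by simpa using h.leaf_mem (π.symm c)
  le_col r c hd := h.le_row _ _ (mem_transpose.1 hd)
  le_row r c hd := h.le_col _ _ (mem_transpose.1 hd)
  parent r c hd h0 := by
    have := h.parent c r (mem_transpose.1 hd) (by tauto)
    simp only [mem_transpose]
    exact (iff_not_comm.1 this).trans Iff.rfl

theorem root_mem (h : IsCnatOf π T) : ((0 : Fin (m + 1)), (0 : Fin (m + 1))) ∈ T := by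
  obtain ⟨s, hs, hmin⟩ := Finset.exists_minimal
    (s := Finset.univ.filter fun s => ((0 : Fin (m + 1)), s) ∈ T)
    ⟨π.symm 0, by simpa using h.leaf_mem (π.symm 0)⟩
  simp only [Finset.mem_filter, Finset.mem_univ, true_and] at hs hmin
  by_cases h0 : s = 0
  · rwa [h0] at hs
  · obtain ⟨r', hr', -⟩ := (h.parent 0 s hs (by tauto)).2 (by
      rintro ⟨c', hc', hd⟩
      exact absurd (hmin hd hc'.le) (not_le.2 hc'))
    exact absurd hr' (Fin.not_lt_zero _)

/-- Exchange of the dot `(r₁, c₂)` for `(r₂, c₁)`: the dot `(r₂, c₂)`, which had its parent above,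
gets its parent to the left. -/
theorem rotate (h : IsCnatOf π T) {r₁ r₂ c₁ c₂ : Fin (m + 1)} (hr : r₁ < r₂) (hc : c₁ < c₂)
    (h₁₂ : (r₁, c₂) ∈ T) (h₂₂ : (r₂, c₂) ∈ T) (htop : ∀ r < r₂, (r, c₂) ∈ T → r = r₁)
    (hleft : ∃ c < c₂, (r₁, c) ∈ T) (habove : ∃ r < r₂, (r, c₁) ∈ T) (hlt : r₂ < π c₁) :
    IsCnatOf π (insert (r₂, c₁) (T.erase (r₁, c₂))) := by
  have hnl := (h.parent _ _ h₂₂ (by rintro ⟨rfl, rfl⟩; exact absurd hr (Fin.not_lt_zero _))).1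
    ⟨r₁, hr, h₁₂⟩
  have hne : ∀ c, π c = r₁ → c ≠ c₂ := by
    rintro c hπ rfl
    have := h.le_col _ _ h₂₂
    rw [hπ] at this
    exact absurd hr (not_lt.2 this)
  have hq := h.le_row _ _ h₂₂
  constructor
  · intro c
    have := h.leaf_mem c
    have := hne c
    simp only [Finset.mem_insert, Finset.mem_erase, Prod.mk.injEq, ne_eq]
    tauto
  · intro r c hd
    simp only [Finset.mem_insert, Finset.mem_erase, Prod.mk.injEq, ne_eq] at hd
    rcases hd with ⟨rfl, rfl⟩ | ⟨-, hd⟩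
    · exact hlt.le
    · exact h.le_col _ _ hd
  · intro r c hd
    simp only [Finset.mem_insert, Finset.mem_erase, Prod.mk.injEq, ne_eq] at hd
    rcases hd with ⟨rfl, rfl⟩ | ⟨-, hd⟩
    · exact hc.le.trans hq
    · exact h.le_row _ _ hd
  · intro r c hd h0
    have hmem : ∀ a b, (a, b) ∈ insert (r₂, c₁) (T.erase (r₁, c₂)) ↔
        (a = r₂ ∧ b = c₁) ∨ ¬ (a = r₁ ∧ b = c₂) ∧ (a, b) ∈ T := by simp
    simp only [hmem] at hd ⊢
    rcases hd with ⟨rfl, rfl⟩ | ⟨hd', hd⟩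
    · obtain ⟨r, hr', hd⟩ := habove
      refine ⟨fun _ => ?_, fun _ => ⟨r, hr', Or.inr ⟨by rintro ⟨rfl, rfl⟩; exact hc.ne rfl, hd⟩⟩⟩
      rintro ⟨c', hc', h' | h'⟩
      · exact hc'.ne h'.2
      · exact hnl ⟨c', hc'.trans hc, h'.2⟩
    by_cases h2 : r = r₂ ∧ c = c₂
    · obtain ⟨rfl, rfl⟩ := h2
      refine iff_of_false ?_ (not_not.2 ⟨c₁, hc, Or.inl ⟨rfl, rfl⟩⟩)
      rintro ⟨r', hr', h' | h'⟩
      · exact hc.ne h'.2.symm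
      · exact h'.1 ⟨htop _ hr' h'.2, rfl⟩
    -- Other dots keep their parent conditions: below the erased dot `(r₁, c₂)` in its column, `(r₂,
    -- c₂)` replaces it as a witness, since by `htop` no dot lies strictly between them.
    have hA : (∃ r' < r, r' = r₂ ∧ c = c₁ ∨ ¬ (r' = r₁ ∧ c = c₂) ∧ (r', c) ∈ T) ↔
        ∃ r' < r, (r', c) ∈ T := by
      constructor
      · rintro ⟨r', hr', ⟨rfl, rfl⟩ | h'⟩
        · obtain ⟨s, hs, hd⟩ := habove
          exact ⟨s, hs.trans hr', hd⟩
        · exact ⟨r', hr', h'.2⟩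
      · rintro ⟨r', hr', h'⟩
        by_cases h3 : r' = r₁ ∧ c = c₂
        · obtain ⟨rfl, rfl⟩ := h3
          refine ⟨r₂, ?_, Or.inr ⟨fun h => hr.ne h.1.symm, h₂₂⟩⟩
          by_contra h4
          rcases lt_or_eq_of_le (not_lt.1 h4) with h5 | h5
          · exact hr'.ne (htop r h5 hd).symm
          · exact h2 ⟨h5, rfl⟩
        · exact ⟨r', hr', Or.inr ⟨h3, h'⟩⟩
    have hL : (∃ c' < c, r = r₂ ∧ c' = c₁ ∨ ¬ (r = r₁ ∧ c' = c₂) ∧ (r, c') ∈ T) ↔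
        ∃ c' < c, (r, c') ∈ T := by
      constructor
      · rintro ⟨c', hc', ⟨rfl, rfl⟩ | h'⟩
        · refine ⟨c₂, ?_, h₂₂⟩
          by_contra h4
          rcases lt_or_eq_of_le (not_lt.1 h4) with h5 | h5
          · exact hnl ⟨c, h5, hd⟩
          · exact h2 ⟨rfl, h5⟩
        · exact ⟨c', hc', h'.2⟩
      · rintro ⟨c', hc', h'⟩
        by_cases h3 : r = r₁ ∧ c' = c₂
        · obtain ⟨rfl, rfl⟩ := h3
          obtain ⟨s, hs, hd⟩ := hleft
          exact ⟨s, hs.trans hc', Or.inr ⟨fun h => hs.ne h.2, hd⟩⟩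
        · exact ⟨c', hc', Or.inr ⟨h3, h'⟩⟩
    rw [hA, hL]
    exact h.parent r c hd h0

/-- Sliding the leftmost dot `(r, c₁)` of a row to the cell `(r, c₂)`, to the left of all other dots
of the row. -/
theorem slide (h : IsCnatOf π T) {r c₁ c₂ : Fin (m + 1)} (hne : c₁ ≠ c₂) (h₁ : (r, c₁) ∈ T)
    (hrest : ∀ c, (r, c) ∈ T → c ≠ c₁ → c₁ < c ∧ c₂ < c) (hlt₁ : r < π c₁)
    (habove₁ : ∃ r' < r, (r', c₁) ∈ T) (habove : ∃ r' < r, (r', c₂) ∈ T) (hlt : r < π c₂) :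
    IsCnatOf π (insert (r, c₂) (T.erase (r, c₁))) := by
  have hleaf : (r, π.symm r) ∈ T := by simpa using h.leaf_mem (π.symm r)
  constructor
  · intro c
    have h1 := h.leaf_mem c
    have h2 : ¬ (π c = r ∧ c = c₁) := by
      rintro ⟨rfl, rfl⟩
      exact hlt₁.ne rfl
    simp only [Finset.mem_insert, Finset.mem_erase, Prod.mk.injEq, ne_eq]
    tauto
  · intro r' c hd
    simp only [Finset.mem_insert, Finset.mem_erase, Prod.mk.injEq, ne_eq] at hd
    rcases hd with ⟨rfl, rfl⟩ | ⟨-, hd⟩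
    · exact hlt.le
    · exact h.le_col _ _ hd
  · intro r' c hd
    simp only [Finset.mem_insert, Finset.mem_erase, Prod.mk.injEq, ne_eq] at hd
    rcases hd with ⟨rfl, rfl⟩ | ⟨-, hd⟩
    · exact (hrest _ hleaf (by rintro rfl; simp at hlt₁)).2.le
    · exact h.le_row _ _ hd
  · intro s c hd h0
    have hmem : ∀ a b, (a, b) ∈ insert (r, c₂) (T.erase (r, c₁)) ↔
        (a = r ∧ b = c₂) ∨ ¬ (a = r ∧ b = c₁) ∧ (a, b) ∈ T := by simp
    simp only [hmem] at hd ⊢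
    rcases hd with ⟨rfl, rfl⟩ | ⟨hd', hd⟩
    · obtain ⟨t, ht, hd⟩ := habove
      refine ⟨fun _ => ?_, fun _ => ⟨t, ht, Or.inr ⟨fun h => ht.ne h.1, hd⟩⟩⟩
      rintro ⟨c', hc', h' | h'⟩
      · exact hc'.ne h'.2
      · exact absurd hc' (not_lt.2 (hrest c' h'.2 fun h => h'.1 ⟨rfl, h⟩).2.le)
    have hA : (∃ r' < s, r' = r ∧ c = c₂ ∨ ¬ (r' = r ∧ c = c₁) ∧ (r', c) ∈ T) ↔
        ∃ r' < s, (r', c) ∈ T := by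
      constructor
      · rintro ⟨r', hr', ⟨rfl, rfl⟩ | h'⟩
        · obtain ⟨s, hs, hd⟩ := habove
          exact ⟨s, hs.trans hr', hd⟩
        · exact ⟨r', hr', h'.2⟩
      · rintro ⟨r', hr', h'⟩
        by_cases h3 : r' = r ∧ c = c₁
        · obtain ⟨rfl, rfl⟩ := h3
          obtain ⟨t, ht, hd⟩ := habove₁
          exact ⟨t, ht.trans hr', Or.inr ⟨fun h => ht.ne h.1, hd⟩⟩
        · exact ⟨r', hr', Or.inr ⟨h3, h'⟩⟩
    -- The remaining dots of row `r` lie to the right of both `c₁` and `c₂`, so either cell serves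
    -- as a witness.
    have hL : (∃ c' < c, s = r ∧ c' = c₂ ∨ ¬ (s = r ∧ c' = c₁) ∧ (s, c') ∈ T) ↔
        ∃ c' < c, (s, c') ∈ T := by
      constructor
      · rintro ⟨c', hc', ⟨rfl, rfl⟩ | h'⟩
        · exact ⟨c₁, (hrest c hd fun h => hd' ⟨rfl, h⟩).1, h₁⟩
        · exact ⟨c', hc', h'.2⟩
      · rintro ⟨c', hc', h'⟩
        by_cases h3 : s = r ∧ c' = c₁
        · obtain ⟨rfl, rfl⟩ := h3
          exact ⟨c₂, (hrest c hd fun h => hd' ⟨rfl, h⟩).2, Or.inl ⟨rfl, rfl⟩⟩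
        · exact ⟨c', hc', Or.inr ⟨h3, h'⟩⟩
    rw [hA, hL]
    exact h.parent s c hd h0

theorem transpose_insert_erase {m : ℕ} (T : Filling m m) (a b c d : Fin m) :
    CNAT.transpose (insert (a, b) ((CNAT.transpose T).erase (c, d))) =
      insert (b, a) (T.erase (d, c)) := by
  ext ⟨r, s⟩
  simp
  tauto

/-- The transpose of `rotate`. -/
theorem rotate' (h : IsCnatOf π T) {r₁ r₂ c₁ c₂ : Fin (m + 1)} (hr : r₁ < r₂) (hc : c₁ < c₂)
    (h₂₁ : (r₂, c₁) ∈ T) (h₂₂ : (r₂, c₂) ∈ T) (htop : ∀ c < c₂, (r₂, c) ∈ T → c = c₁)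
    (habove : ∃ r < r₂, (r, c₁) ∈ T) (hleft : ∃ c < c₂, (r₁, c) ∈ T) (hlt : c₂ < π.symm r₁) :
    IsCnatOf π (insert (r₁, c₂) (T.erase (r₂, c₁))) := by
  have := (h.transpose.rotate (r₁ := c₁) (r₂ := c₂) (c₁ := r₁) (c₂ := r₂) hc hr
    (by simpa) (by simpa) (by simpa) (by simpa) (by simpa) hlt).transpose
  rwa [transpose_insert_erase] at this

end IsCnatOf

theorem cnat_eq_ncard {m : ℕ} (π : Equiv.Perm (Fin (m + 1))) :
    cnat π = {T | IsCnatOf π T}.ncard := by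
  unfold cnat
  congr 1
  ext T
  exact mem_cnatSet_iff

theorem cnat_symm {m : ℕ} (π : Equiv.Perm (Fin (m + 1))) : cnat π.symm = cnat π := by
  rw [cnat_eq_ncard, cnat_eq_ncard]
  refine Set.ncard_congr (fun T _ => transpose T) (fun T hT => IsCnatOf.transpose hT) ?_ ?_
  · intro S T _ _ h
    rw [← transpose_transpose S, h, transpose_transpose]
  · intro T hT
    exact ⟨transpose T, IsCnatOf.transpose hT, transpose_transpose T⟩

/-- The exchange is undone by erasing `x` and restoring `y`, so it is injective on `P`. -/
theorem ncard_le_of_exchange {α : Type*} [Fintype α] [DecidableEq α] {P Q : Set (Finset α)}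
    (x y : α) (hx : ∀ T ∈ P, x ∉ T) (hy : ∀ T ∈ P, y ∈ T)
    (h : ∀ T ∈ P, insert x (T.erase y) ∈ Q) : P.ncard ≤ Q.ncard := by
  refine Set.ncard_le_ncard_of_injOn (fun T => insert x (T.erase y)) h ?_ (Set.toFinite _)
  intro S hS T hT he
  have hS' := hx S hS
  have hT' := hx T hT
  have e : ∀ U : Finset α, x ∉ U → (insert x (U.erase y)).erase x = U.erase y := fun U hU =>
    Finset.erase_insert fun h => hU (Finset.mem_of_mem_erase h)
  rw [← Finset.insert_erase (hy S hS), ← Finset.insert_erase (hy T hT), ← e S hS', ← e T hT']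
  exact congrArg _ (congrArg (fun U => Finset.erase U x) he)

/-! ### The four classes of the top-left corner -/

section Corner

variable {m : ℕ} {π : Equiv.Perm (Fin (m + 2))} {T : Filling (m + 2) (m + 2)}

theorem eq_zero_of_lt_one {r : Fin (m + 2)} (hr : r < 1) : r = 0 := by
  rw [Fin.lt_def] at hr
  exact Fin.ext (by simpa using hr)

theorem exists_lt_one {p : Fin (m + 2) → Prop} : (∃ r < 1, p r) ↔ p 0 := by
  constructor
  · rintro ⟨r, hr, h⟩
    rwa [← eq_zero_of_lt_one hr]
  · intro h
    exact ⟨0, by simp, h⟩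

theorem IsCnatOf.corner (h : IsCnatOf π T) (h₁ : ((1 : Fin (m + 2)), (1 : Fin (m + 2))) ∈ T) :
    (0, 1) ∈ T ↔ (1, 0) ∉ T := by
  have := h.parent 1 1 h₁ (by simp)
  rwa [exists_lt_one, exists_lt_one (p := fun c => (1, c) ∈ T)] at this

theorem one_lt_of_ne {c : Fin (m + 2)} (h0 : c ≠ 0) (h1 : c ≠ 1) : 1 < c := by
  rw [Fin.lt_def]
  have h0' : (c : ℕ) ≠ 0 := fun h => h0 (Fin.ext h)
  have h1' : (c : ℕ) ≠ 1 := fun h => h1 (Fin.ext (by simpa using h))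
  rw [Fin.val_one]
  omega

/-- The CNATs with dots at `(1, 1)` and `(0, 1)`. -/
def cornerAbove (π : Equiv.Perm (Fin (m + 2))) : Set (Filling (m + 2) (m + 2)) :=
  {T | IsCnatOf π T ∧ (1, 1) ∈ T ∧ (0, 1) ∈ T}

/-- The CNATs with dots at `(1, 1)` and `(1, 0)`. -/
def cornerLeft (π : Equiv.Perm (Fin (m + 2))) : Set (Filling (m + 2) (m + 2)) :=
  {T | IsCnatOf π T ∧ (1, 1) ∈ T ∧ (1, 0) ∈ T}

/-- The CNATs with dots at `(0, 1)` and `(1, 0)` but not at `(1, 1)`. -/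
def cornerBoth (π : Equiv.Perm (Fin (m + 2))) : Set (Filling (m + 2) (m + 2)) :=
  {T | IsCnatOf π T ∧ (1, 1) ∉ T ∧ (0, 1) ∈ T ∧ (1, 0) ∈ T}

/-- The CNATs without dots at `(1, 1)` and `(1, 0)`, or at `(1, 1)` and `(0, 1)`. -/
def cornerFree (π : Equiv.Perm (Fin (m + 2))) : Set (Filling (m + 2) (m + 2)) :=
  {T | IsCnatOf π T ∧ (1, 1) ∉ T ∧ ¬ ((0, 1) ∈ T ∧ (1, 0) ∈ T)}

theorem cnat_eq_corner (π : Equiv.Perm (Fin (m + 2))) :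
    cnat π = (cornerAbove π).ncard + (cornerLeft π).ncard + (cornerBoth π).ncard +
      (cornerFree π).ncard := by
  rw [cnat_eq_ncard, ← Set.ncard_union_eq, ← Set.ncard_union_eq, ← Set.ncard_union_eq]
  · congr 1
    ext T
    have := fun h : IsCnatOf π T => h.corner
    simp only [cornerAbove, cornerLeft, cornerBoth, cornerFree, Set.mem_union, Set.mem_ofPred_eq]
    tauto
  all_goals
    rw [Set.disjoint_left]
    intro T
    have := fun h : IsCnatOf π T => h.corner
    simp only [cornerAbove, cornerLeft, cornerBoth, cornerFree, Set.mem_union, Set.mem_ofPred_eq]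
    tauto

/-- The rotations between `(0, 1)` and `(1, 0)` are mutually inverse; `ha` and `hb` keep these cells
strictly before the leaves of row 0 and column 0. -/
theorem ncard_cornerAbove_eq_cornerLeft (ha : 1 < π.symm 0) (hb : 1 < π 0) :
    (cornerAbove π).ncard = (cornerLeft π).ncard := by
  have h01 : (0 : Fin (m + 2)) < 1 := by simp
  apply le_antisymm
  · apply ncard_le_of_exchange (1, 0) (0, 1)
    · rintro T ⟨h, h1, h2⟩
      exact (h.corner h1).1 h2
    · rintro T ⟨h, h1, h2⟩
      exact h2
    · rintro T ⟨h, h1, h2⟩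
      refine ⟨h.rotate h01 h01 h2 h1 ?_ ⟨0, h01, h.root_mem⟩ ⟨0, h01, h.root_mem⟩ hb, ?_, ?_⟩
      · intro r hr _
        exact eq_zero_of_lt_one hr
      · simp [h1]
      · simp
  · apply ncard_le_of_exchange (0, 1) (1, 0)
    · rintro T ⟨h, h1, h2⟩ h3
      exact (h.corner h1).1 h3 h2
    · rintro T ⟨h, h1, h2⟩
      exact h2
    · rintro T ⟨h, h1, h2⟩
      refine ⟨h.rotate' h01 h01 h2 h1 ?_ ⟨0, h01, h.root_mem⟩ ⟨0, h01, h.root_mem⟩ ha, ?_, ?_⟩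
      · intro r hr _
        exact eq_zero_of_lt_one hr
      · simp [h1]
      · simp

/-- With `(0, 1)` dotted, the first dot of row 1 slides freely between columns 0 and 1. -/
theorem ncard_cornerAbove_eq_cornerBoth (hb : 1 < π 0) (h₁ : 1 < π 1) :
    (cornerAbove π).ncard = (cornerBoth π).ncard := by
  have h01 : (0 : Fin (m + 2)) < 1 := by simp
  apply le_antisymm
  · apply ncard_le_of_exchange (1, 0) (1, 1)
    · rintro T ⟨h, h1, h2⟩
      exact (h.corner h1).1 h2
    · rintro T ⟨h, h1, h2⟩
      exact h1
    · rintro T ⟨h, h1, h2⟩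
      refine ⟨h.slide h01.ne' h1 ?_ h₁ ⟨0, h01, h2⟩ ⟨0, h01, h.root_mem⟩ hb, ?_, ?_, ?_⟩
      · intro c hc hc1
        have : c ≠ 0 := by
          rintro rfl
          exact (h.corner h1).1 h2 hc
        exact ⟨one_lt_of_ne this hc1, Fin.pos_iff_ne_zero.2 this⟩
      · simp
      · simp [h2]
      · simp
  · apply ncard_le_of_exchange (1, 1) (1, 0)
    · rintro T ⟨h, h1, h2, h3⟩
      exact h1
    · rintro T ⟨h, h1, h2, h3⟩
      exact h3
    · rintro T ⟨h, h1, h2, h3⟩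
      refine ⟨h.slide h01.ne h3 ?_ hb ⟨0, h01, h.root_mem⟩ ⟨0, h01, h2⟩ h₁, ?_, ?_⟩
      · intro c hc hc1
        have : c ≠ 1 := by
          rintro rfl
          exact h1 hc
        exact ⟨Fin.pos_iff_ne_zero.2 hc1, one_lt_of_ne hc1 this⟩
      · simp
      · simp [h2]

end Corner

theorem IsCnatOf.exists_leftmost {m : ℕ} {π : Equiv.Perm (Fin (m + 1))}
    {T : Filling (m + 1) (m + 1)} (h : IsCnatOf π T) (r : Fin (m + 1)) :
    ∃ c, (r, c) ∈ T ∧ ∀ c' < c, (r, c') ∉ T := by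
  obtain ⟨s, hs, hmin⟩ := Finset.exists_minimal
    (s := Finset.univ.filter fun s => (r, s) ∈ T)
    ⟨π.symm r, by simpa using h.leaf_mem (π.symm r)⟩
  simp only [Finset.mem_filter, Finset.mem_univ, true_and] at hs hmin
  exact ⟨s, hs, fun c hc hm => absurd (hmin hm hc.le) (not_le.2 hc)⟩

section Corner

variable {m : ℕ} {π : Equiv.Perm (Fin (m + 2))} {T : Filling (m + 2) (m + 2)}

/-- The leftmost dot of row `1` has a dot of row `0` above it. -/
theorem IsCnatOf.exists_leftmost_one (h : IsCnatOf π T) :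
    ∃ c, (1, c) ∈ T ∧ (∀ c' < c, (1, c') ∉ T) ∧ (0, c) ∈ T := by
  obtain ⟨c, hc, hmin⟩ := h.exists_leftmost 1
  refine ⟨c, hc, hmin, exists_lt_one.1 ((h.parent 1 c hc (by simp)).2 ?_)⟩
  rintro ⟨c', hc', hm⟩
  exact hmin c' hc' hm

/-- The root would be a leaf, so no dot of row 0 beyond it could carry row 1. -/
theorem cnat_eq_zero_of_fixed (h0 : π 0 = 0) : cnat π = 0 := by
  rw [cnat_eq_ncard, Set.ncard_eq_zero, Set.eq_empty_iff_forall_notMem]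
  intro T (h : IsCnatOf π T)
  obtain ⟨c, hc, -, h0c⟩ := h.exists_leftmost_one
  have h1 := h.le_row _ _ h0c
  rw [← h0, Equiv.symm_apply_apply] at h1
  obtain rfl : c = 0 := le_antisymm h1 (Fin.zero_le _)
  have h2 := h.le_col _ _ hc
  rw [h0] at h2
  simp at h2

/-- Rotate at the leftmost dot `(1, c)` of row 1, trading its parent `(0, c)` for `(1, 0)`; as `c ≠
1`, a dot at `(0, 1)` survives. -/
theorem IsCnatOf.exists_insert_one_zero (h : IsCnatOf π T) (hb : 1 < π 0) (h₁₁ : (1, 1) ∉ T)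
    (h₁₀ : (1, 0) ∉ T) :
    ∃ T', IsCnatOf π T' ∧ (1, 1) ∉ T' ∧ (1, 0) ∈ T' ∧ ((0, 1) ∈ T → (0, 1) ∈ T') := by
  obtain ⟨c, hc, hmin, h0c⟩ := h.exists_leftmost_one
  have hc0 : c ≠ 0 := by rintro rfl; exact h₁₀ hc
  have hc1 : c ≠ 1 := by rintro rfl; exact h₁₁ hc
  have h01 : (0 : Fin (m + 2)) < 1 := by simp
  have hpos := Fin.pos_iff_ne_zero.2 hc0
  refine ⟨_, h.rotate h01 hpos h0c hc (fun r hr _ => eq_zero_of_lt_one hr)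
    ⟨0, hpos, h.root_mem⟩ ⟨0, h01, h.root_mem⟩ hb, ?_, ?_, ?_⟩
  · simp [h₁₁]
  · simp
  · intro h'
    simp [h', hc1.symm]

theorem IsCnatOf.exists_insert_zero_one (h : IsCnatOf π T) (ha : 1 < π.symm 0)
    (h₁₁ : (1, 1) ∉ T) (h₁₀ : (0, 1) ∉ T) :
    ∃ T', IsCnatOf π T' ∧ (1, 1) ∉ T' ∧ (0, 1) ∈ T' ∧ ((1, 0) ∈ T → (1, 0) ∈ T') := by
  obtain ⟨T', h', h1, h2, h3⟩ := h.transpose.exists_insert_one_zero ha (by simpa) (by simpa)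
  refine ⟨CNAT.transpose T', h'.transpose, by simpa, by simpa, by simpa using h3⟩

/-- Were the class empty, the two equinumerous classes would be too, leaving a CNAT in `cornerFree`;
at most two rotations then create the missing dots. -/
theorem cornerBoth_nonempty (ha : 1 < π.symm 0) (hb : 1 < π 0) (h₁ : 1 < π 1)
    (hπ : cnat π ≠ 0) : (cornerBoth π).Nonempty := by
  rw [← Set.ncard_pos]
  by_contra h0
  have e1 := ncard_cornerAbove_eq_cornerLeft ha hb
  have e2 := ncard_cornerAbove_eq_cornerBoth hb h₁
  have e3 := cnat_eq_corner π
  have h4 : (cornerFree π).ncard ≠ 0 := by omega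
  obtain ⟨T, h, h11, hno⟩ := Set.nonempty_of_ncard_ne_zero h4
  apply h0
  rw [Set.ncard_pos]
  have key : ∀ T, IsCnatOf π T → (1, 1) ∉ T → (0, 1) ∈ T → (cornerBoth π).Nonempty := by
    intro T h h11 h01
    by_cases h10 : (1, 0) ∈ T
    · exact ⟨T, h, h11, h01, h10⟩
    · obtain ⟨T', h', h1, h2, h3⟩ := h.exists_insert_one_zero hb h11 h10
      exact ⟨T', h', h1, h3 h01, h2⟩
  by_cases h01 : (0, 1) ∈ T
  · exact key T h h11 h01
  · obtain ⟨T', h', h1, h2, h3⟩ := h.exists_insert_zero_one ha h11 h01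
    exact key T' h' h1 h2

end Corner

/-! ### Reaching the fourth class -/

section Free

variable {m : ℕ} {π : Equiv.Perm (Fin (m + 3))} {T : Filling (m + 3) (m + 3)}

theorem eq_zero_or_one_of_lt_two {r : Fin (m + 3)} (hr : r < 2) : r = 0 ∨ r = 1 := by
  have : ((2 : Fin (m + 3)) : ℕ) = 2 := rfl
  rw [Fin.lt_def, this] at hr
  rw [Fin.ext_iff, Fin.ext_iff, Fin.val_zero, Fin.val_one]
  omega

theorem cornerFree_nonempty (ha : 2 < π.symm 0) (hb : 1 < π 0)
    (h : (cornerBoth π).Nonempty) : (cornerFree π).Nonempty := by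
  obtain ⟨T, h, h11, h01, h10⟩ := h
  have z1 : (0 : Fin (m + 3)) < 1 := by simp
  have z2 : (0 : Fin (m + 3)) < 2 := show (0 : ℕ) < 2 by omega
  have l2 : (1 : Fin (m + 3)) < 2 := show (1 : ℕ) < 2 by omega
  have hleaf : (1, π.symm 1) ∈ T := by simpa using h.leaf_mem (π.symm 1)
  have hs0 : π.symm 1 ≠ 0 := by
    intro e
    rw [Equiv.symm_apply_eq] at e
    exact hb.ne e
  -- `t` is the column of the second dot of row 1. If it precedes the leaf of row 0, then `(1, 0)`
  -- can be traded for `(0, t)`. Otherwise `t > 2`, and `(1, 0)` can slide to `(1, 2)` once `(0, 2)`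
  -- is dotted.
  obtain ⟨t, ⟨ht, ht0⟩, hmin⟩ := Finset.exists_minimal
    (s := Finset.univ.filter fun s => (1, s) ∈ T ∧ s ≠ 0) ⟨π.symm 1, by simp [hleaf, hs0]⟩
    |>.imp fun t ht => (by simpa using ht.1 : (1, t) ∈ T ∧ t ≠ 0) |> fun h => And.intro h ht.2
  have hmin' : ∀ c < t, (1, c) ∈ T → c = 0 := by
    intro c hc hm
    by_contra h0
    exact absurd (hmin (by simp [hm, h0]) hc.le) (not_le.2 hc)
  have tpos := Fin.pos_iff_ne_zero.2 ht0
  by_cases hta : t < π.symm 0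
  · refine ⟨_, h.rotate' z1 tpos h10 ht hmin' ⟨0, z1, h.root_mem⟩ ⟨0, tpos, h.root_mem⟩ hta,
      ?_, ?_⟩
    · simp [h11]
    · simp
  have ht2 : 2 < t := ha.trans_le (not_lt.1 hta)
  have hπ2 : 1 < π 2 := by
    apply one_lt_of_ne
    · intro e
      rw [← Equiv.eq_symm_apply] at e
      exact ha.ne e
    · intro e
      rw [← Equiv.eq_symm_apply] at e
      have := h.le_row _ _ ht
      rw [← e] at this
      exact absurd ht2 (not_lt.2 this)
  have key : ∀ T, IsCnatOf π T → (1, 1) ∉ T → (1, 0) ∈ T → (0, 2) ∈ T →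
      (∀ c < t, (1, c) ∈ T → c = 0) → (cornerFree π).Nonempty := by
    intro T h h11 h10 h02 hmin'
    refine ⟨_, h.slide (r := 1) (c₁ := 0) (c₂ := 2) z2.ne h10 ?_ hb ⟨0, z1, h.root_mem⟩
      ⟨0, z1, h02⟩ hπ2, ?_, ?_⟩
    · intro c hc hc0
      exact ⟨Fin.pos_iff_ne_zero.2 hc0, ht2.trans_le (not_lt.1 fun hlt => hc0 (hmin' c hlt hc))⟩
    · simp [h11, l2.ne]
    · simp [z2.ne]
  by_cases h02 : (0, 2) ∈ T
  · exact key T h h11 h10 h02 hmin'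
  -- The top dot `(s, 2)` of column 2 has its parent in column 0 or 1. Exactly one of these cells of
  -- row `s` is dotted, and trading it for `(0, 2)` reduces to `key`.
  obtain ⟨s, hs, hsmin⟩ := h.transpose.exists_leftmost 2
  simp only [mem_transpose] at hs hsmin
  have hs0 : s ≠ 0 := by rintro rfl; exact h02 hs
  have hs1 : s ≠ 1 := by
    rintro rfl
    exact z2.ne' (hmin' 2 ht2 hs)
  have spos := Fin.pos_iff_ne_zero.2 hs0
  have hleft : ∃ c < 2, (s, c) ∈ T := by
    by_contra hno
    obtain ⟨r, hr, hd⟩ := (h.parent s 2 hs (fun e => hs0 e.1)).2 hno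
    exact hsmin r hr hd
  obtain ⟨c, hc2, hc⟩ := hleft
  have h0c : (0, c) ∈ T := by
    rcases eq_zero_or_one_of_lt_two hc2 with rfl | rfl
    · exact h.root_mem
    · exact h01
  have hnot : ¬ ((s, 0) ∈ T ∧ (s, 1) ∈ T) := by
    rintro ⟨e0, e1⟩
    exact (h.parent s 1 e1 (fun e => hs0 e.1)).1 ⟨0, spos, h01⟩ ⟨0, z1, e0⟩
  have huniq : ∀ c' < 2, (s, c') ∈ T → c' = c := by
    intro c' hc'2 hc'
    rcases eq_zero_or_one_of_lt_two hc2 with rfl | rfl <;>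
      rcases eq_zero_or_one_of_lt_two hc'2 with rfl | rfl <;> tauto
  refine key _ (h.rotate' spos hc2 hc hs huniq ⟨0, spos, h0c⟩ ⟨0, z2, h.root_mem⟩ ha)
    ?_ ?_ ?_ ?_
  · simp [h11]
  · simp [h10, hs1.symm]
  · simp
  · intro c' hlt hm
    refine hmin' c' hlt ?_
    simpa [hs1.symm] using hm

end Free

/-! ### Inserting a point into a permutation -/

/-- The permutation which maps `a` to `r` and otherwise is order isomorphic to `σ`. -/
def insertPerm {n : ℕ} (σ : Equiv.Perm (Fin n)) (a r : Fin (n + 1)) : Equiv.Perm (Fin (n + 1)) :=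
  (finSuccEquiv' a).trans (σ.optionCongr.trans (finSuccEquiv' r).symm)

section insertPerm

variable {n : ℕ} (σ : Equiv.Perm (Fin n)) (a r : Fin (n + 1))

@[simp] theorem insertPerm_self : insertPerm σ a r a = r := by
  simp [insertPerm]

@[simp] theorem insertPerm_succAbove (i : Fin n) :
    insertPerm σ a r (a.succAbove i) = r.succAbove (σ i) := by
  simp [insertPerm]

theorem insertPerm_symm : (insertPerm σ a r).symm = insertPerm σ.symm r a := rfl

theorem insertPerm_injective : Function.Injective fun σ : Equiv.Perm (Fin n) => insertPerm σ a r := by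
  intro σ τ h
  ext i : 1
  have := DFunLike.congr_fun h (a.succAbove i)
  simpa using this

theorem exists_eq_insertPerm (π : Equiv.Perm (Fin (n + 1))) : ∃ σ, π = insertPerm σ a (π a) := by
  refine ⟨Equiv.removeNone ((finSuccEquiv' a).symm.trans (π.trans (finSuccEquiv' (π a)))), ?_⟩
  ext i : 1
  rcases Fin.eq_self_or_eq_succAbove a i with rfl | ⟨j, rfl⟩
  · simp
  · rw [insertPerm_succAbove]
    have h : ∃ k, ((finSuccEquiv' a).symm.trans (π.trans (finSuccEquiv' (π a)))) (some j) =
        some k := by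
      rcases Fin.eq_self_or_eq_succAbove (π a) (π (a.succAbove j)) with h | ⟨k, h⟩
      · exact absurd (π.injective h) (Fin.succAbove_ne a j)
      · exact ⟨k, by simp [h]⟩
    have h' := Equiv.removeNone_some _ h
    simp only [Equiv.trans_apply, finSuccEquiv'_symm_some] at h'
    rw [← finSuccEquiv'_symm_some (π a), h', Equiv.symm_apply_apply]

end insertPerm

/-! ### Inserting a top row and a column into a CNAT -/

section Insertion

variable {m : ℕ} {σ : Equiv.Perm (Fin (m + 1))} {a : Fin (m + 2)}

theorem succAbove_zero_of_ne (ha : a ≠ 0) : a.succAbove 0 = 0 := Fin.succAbove_ne_zero_zero ha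

theorem exists_lt_succ_iff {r : Fin (m + 1)} {p : Fin (m + 2) → Prop} :
    (∃ r' < r.succ, p r') ↔ p 0 ∨ ∃ r' < r, p r'.succ := by
  rw [Fin.exists_fin_succ]
  simp

theorem exists_lt_succAbove_iff {c : Fin (m + 1)} {p : Fin (m + 2) → Prop} (hp : ¬ p a) :
    (∃ c' < a.succAbove c, p c') ↔ ∃ c' < c, p (a.succAbove c') := by
  constructor
  · rintro ⟨c', hc', h⟩
    rcases Fin.eq_self_or_eq_succAbove a c' with rfl | ⟨j, rfl⟩
    · exact absurd h hp
    · exact ⟨j, Fin.succAbove_lt_succAbove_iff.1 hc', h⟩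
  · rintro ⟨c', hc', h⟩
    exact ⟨_, Fin.succAbove_lt_succAbove_iff.2 hc', h⟩

/-- The filling `T` arises from `S` by insertion of a row at the top, with dots in columns `0`
and `a`, and of a column `a`. -/
structure IsInsertion (a : Fin (m + 2)) (S : Filling (m + 1) (m + 1))
    (T : Filling (m + 2) (m + 2)) : Prop where
  top : ∀ c, (0, c) ∈ T ↔ c = 0 ∨ c = a
  col : ∀ r : Fin (m + 1), (r.succ, a) ∉ T
  rest : ∀ r c : Fin (m + 1), (r.succ, a.succAbove c) ∈ T ↔ (r, c) ∈ S

namespace IsInsertion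

variable {S : Filling (m + 1) (m + 1)} {T : Filling (m + 2) (m + 2)}

/-- Since `a ≠ 0`, column 0 stays in place, and it is the only old column to gain a dot on top: the
new root. -/
theorem above_iff (h : IsInsertion a S T) (ha : a ≠ 0) (r c : Fin (m + 1)) :
    (∃ r' < r.succ, (r', a.succAbove c) ∈ T) ↔ c = 0 ∨ ∃ r' < r, (r', c) ∈ S := by
  rw [exists_lt_succ_iff, h.top]
  simp only [h.rest, Fin.succAbove_ne, or_false]
  rw [← Fin.succAbove_eq_zero_iff ha]

theorem left_iff (h : IsInsertion a S T) (r c : Fin (m + 1)) :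
    (∃ c' < a.succAbove c, (r.succ, c') ∈ T) ↔ ∃ c' < c, (r, c') ∈ S := by
  rw [exists_lt_succAbove_iff (p := fun c' => (r.succ, c') ∈ T) (h.col r)]
  simp only [h.rest]

theorem isCnatOf (h : IsInsertion a S T) (ha : a ≠ 0) (hS : IsCnatOf σ S) :
    IsCnatOf (insertPerm σ a 0) T := by
  have hpos := Fin.pos_iff_ne_zero.2 ha
  constructor
  · intro c
    rcases Fin.eq_self_or_eq_succAbove a c with rfl | ⟨c, rfl⟩
    · simp [h.top]
    · rw [insertPerm_succAbove, Fin.succAbove_zero, h.rest]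
      exact hS.leaf_mem c
  · intro r c hd
    rcases Fin.eq_zero_or_eq_succ r with rfl | ⟨r, rfl⟩
    · exact Fin.zero_le _
    · rcases Fin.eq_self_or_eq_succAbove a c with rfl | ⟨c, rfl⟩
      · exact absurd hd (h.col r)
      · rw [insertPerm_succAbove, Fin.succAbove_zero, Fin.succ_le_succ_iff]
        exact hS.le_col r c ((h.rest r c).1 hd)
  · intro r c hd
    rw [insertPerm_symm]
    rcases Fin.eq_zero_or_eq_succ r with rfl | ⟨r, rfl⟩
    · rw [insertPerm_self]
      rcases (h.top c).1 hd with rfl | rfl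
      · exact Fin.zero_le _
      · exact le_rfl
    · rcases Fin.eq_self_or_eq_succAbove a c with rfl | ⟨c, rfl⟩
      · exact absurd hd (h.col r)
      · rw [← Fin.succAbove_zero, insertPerm_succAbove, Fin.succAbove_le_succAbove_iff]
        exact hS.le_row r c ((h.rest r c).1 hd)
  · intro r c hd h0
    rcases Fin.eq_zero_or_eq_succ r with rfl | ⟨r, rfl⟩
    · rcases (h.top c).1 hd with rfl | rfl
      · exact absurd ⟨rfl, rfl⟩ h0
      · refine iff_of_false ?_ (not_not.2 ⟨0, hpos, (h.top 0).2 (Or.inl rfl)⟩)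
        rintro ⟨r', hr', -⟩
        exact Fin.not_lt_zero _ hr'
    · rcases Fin.eq_self_or_eq_succAbove a c with rfl | ⟨c, rfl⟩
      · exact absurd hd (h.col r)
      · rw [h.above_iff ha, h.left_iff]
        by_cases hc : c = 0
        · subst hc
          simp
        · rw [or_iff_right hc]
          exact hS.parent r c ((h.rest r c).1 hd) fun e => hc e.2

theorem of_isCnatOf (h : IsInsertion a S T) (ha : a ≠ 0) (hT : IsCnatOf (insertPerm σ a 0) T) :
    IsCnatOf σ S := by
  -- The leftmost dot of row 1 lies under a dot of row 0, hence in column 0 or `a`; but column `a`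
  -- has no dot below row 0. This root supplies the parents in column 0 of `S`.
  have hroot : (0, 0) ∈ S := by
    obtain ⟨c, hc, -, h0⟩ := hT.exists_leftmost_one
    rw [← Fin.succ_zero_eq_one] at hc
    rcases (h.top c).1 h0 with rfl | rfl
    · rw [← succAbove_zero_of_ne ha] at hc
      exact (h.rest 0 0).1 hc
    · exact absurd hc (h.col 0)
  constructor
  · intro c
    have := hT.leaf_mem (a.succAbove c)
    rwa [insertPerm_succAbove, Fin.succAbove_zero, h.rest] at this
  · intro r c hd
    have := hT.le_col _ _ ((h.rest r c).2 hd)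
    rwa [insertPerm_succAbove, Fin.succAbove_zero, Fin.succ_le_succ_iff] at this
  · intro r c hd
    have := hT.le_row _ _ ((h.rest r c).2 hd)
    rwa [insertPerm_symm, ← Fin.succAbove_zero, insertPerm_succAbove,
      Fin.succAbove_le_succAbove_iff] at this
  · intro r c hd h0
    have := hT.parent _ _ ((h.rest r c).2 hd) fun e => Fin.succ_ne_zero _ e.1
    rw [h.above_iff ha, h.left_iff] at this
    by_cases hc : c = 0
    · subst hc
      have hr : r ≠ 0 := fun e => h0 ⟨e, rfl⟩
      refine iff_of_true ⟨0, Fin.pos_iff_ne_zero.2 hr, hroot⟩ (by simp)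
    · rwa [or_iff_right hc] at this

end IsInsertion

/-- The filling obtained by insertion of a row at the top and of a column `a`. -/
def insertion (a : Fin (m + 2)) (S : Filling (m + 1) (m + 1)) : Filling (m + 2) (m + 2) :=
  insert (0, 0) (insert (0, a) (S.image fun d => (d.1.succ, a.succAbove d.2)))

theorem isInsertion_insertion (a : Fin (m + 2)) (S : Filling (m + 1) (m + 1)) :
    IsInsertion a S (insertion a S) where
  top c := by simp [insertion, Fin.succ_ne_zero]
  col r := by simp [insertion, Fin.succ_ne_zero, Fin.succAbove_ne]
  rest r c := by simp [insertion, Fin.succ_ne_zero]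

theorem insertion_injective (a : Fin (m + 2)) : Function.Injective (insertion a) := by
  intro S S' h
  ext ⟨r, c⟩
  rw [← (isInsertion_insertion a S).rest, h, (isInsertion_insertion a S').rest]

theorem eq_insertion (hT : IsCnatOf (insertPerm σ a 0) T) (h : ∀ c, (0, c) ∈ T → c = 0 ∨ c = a) :
    ∃ S, insertion a S = T := by
  refine ⟨Finset.univ.filter fun d => (d.1.succ, a.succAbove d.2) ∈ T, ?_⟩
  set S : Filling (m + 1) (m + 1) := Finset.univ.filter fun d => (d.1.succ, a.succAbove d.2) ∈ T
    with hS
  have hi := isInsertion_insertion a S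
  have ha : (0, a) ∈ T := by simpa using hT.leaf_mem a
  ext ⟨r, c⟩
  rcases Fin.eq_zero_or_eq_succ r with rfl | ⟨r, rfl⟩
  · rw [hi.top]
    refine ⟨?_, h c⟩
    rintro (rfl | rfl)
    · exact hT.root_mem
    · exact ha
  · rcases Fin.eq_self_or_eq_succAbove a c with rfl | ⟨c, rfl⟩
    · refine iff_of_false (hi.col r) fun hd => ?_
      have := hT.le_col _ _ hd
      simp at this
    · rw [hi.rest]
      simp [hS]

/-- The CNATs whose top row has dots in columns `0` and `a` only, `a` being the column of the leaf
in row `0`, are counted by the permutation with the value `0` removed. -/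
theorem ncard_top_row (σ : Equiv.Perm (Fin (m + 1))) (ha : a ≠ 0) :
    {T | IsCnatOf (insertPerm σ a 0) T ∧ ∀ c, (0, c) ∈ T → c = 0 ∨ c = a}.ncard = cnat σ := by
  rw [cnat_eq_ncard, ← Set.ncard_image_of_injective _ (insertion_injective a)]
  congr 1
  ext T
  constructor
  · rintro ⟨hT, h⟩
    obtain ⟨S, rfl⟩ := eq_insertion hT h
    exact ⟨S, (isInsertion_insertion a S).of_isCnatOf ha hT, rfl⟩
  · rintro ⟨S, hS, rfl⟩
    exact ⟨(isInsertion_insertion a S).isCnatOf ha hS,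
      fun c => ((isInsertion_insertion a S).top c).1⟩

/-- The leaf of row 0 is in column 1, so the condition in `ncard_top_row` holds automatically. -/
theorem cnat_insertPerm_one_zero (σ : Equiv.Perm (Fin (m + 1))) :
    cnat (insertPerm σ 1 0) = cnat σ := by
  rw [← ncard_top_row σ (a := 1) (by simp), cnat_eq_ncard]
  congr 1
  ext T
  refine ⟨fun h => ⟨h, fun c hc => ?_⟩, fun h => h.1⟩
  have := IsCnatOf.le_row h _ _ hc
  rw [insertPerm_symm, insertPerm_self] at this
  rcases lt_or_eq_of_le this with h | h
  · exact Or.inl (eq_zero_of_lt_one h)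
  · exact Or.inr h

theorem cnat_insertPerm_zero_one (σ : Equiv.Perm (Fin (m + 1))) :
    cnat (insertPerm σ 0 1) = cnat σ := by
  rw [← cnat_symm, insertPerm_symm, cnat_insertPerm_one_zero, cnat_symm]

end Insertion

/-! ### Permutations with an odd count below four -/

section Classification

variable {m : ℕ} {π : Equiv.Perm (Fin (m + 3))}

theorem four_le_cnat (ha : 2 < π.symm 0) (hb : 1 < π 0) (h₁ : 1 < π 1) (hπ : cnat π ≠ 0) :
    4 ≤ cnat π := by
  have ha' : 1 < π.symm 0 := lt_trans (show (1 : ℕ) < 2 by omega) ha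
  have hne := cornerBoth_nonempty ha' hb h₁ hπ
  have e1 := ncard_cornerAbove_eq_cornerLeft ha' hb
  have e2 := ncard_cornerAbove_eq_cornerBoth hb h₁
  have e3 := cnat_eq_corner π
  have e4 := (Set.ncard_pos).2 (cornerFree_nonempty ha hb hne)
  have e5 := (Set.ncard_pos).2 hne
  omega

/-- Here `(1, 1)` is a leaf, so only the classes `cornerAbove` and `cornerLeft` occur. -/
theorem even_cnat (ha : 1 < π.symm 0) (hb : 1 < π 0) (h₁ : π 1 = 1) : Even (cnat π) := by
  have hmem : ∀ T, IsCnatOf π T → (1, 1) ∈ T := fun T h => by simpa [h₁] using h.leaf_mem 1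
  have hB : cornerBoth π = ∅ :=
    Set.eq_empty_iff_forall_notMem.2 fun T hT => hT.2.1 (hmem T hT.1)
  have hF : cornerFree π = ∅ :=
    Set.eq_empty_iff_forall_notMem.2 fun T hT => hT.2.1 (hmem T hT.1)
  rw [cnat_eq_corner, hB, hF, ncard_cornerAbove_eq_cornerLeft ha hb]
  simp

theorem two_lt_of_ne {c : Fin (m + 3)} (h : 1 < c) (h2 : c ≠ 2) : 2 < c := by
  have e : ((2 : Fin (m + 3)) : ℕ) = 2 := rfl
  rw [Fin.lt_def, Fin.val_one] at h
  rw [ne_eq, Fin.ext_iff, e] at h2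
  rw [Fin.lt_def, e]
  omega

theorem of_odd_cnat_lt_four (ho : Odd (cnat π)) (h4 : cnat π < 4) :
    π 1 = 0 ∨ π 0 = 1 ∨ (π 2 = 0 ∧ π 0 = 2 ∧ 1 < π 1) := by
  by_cases h10 : π 1 = 0
  · exact Or.inl h10
  by_cases h01 : π 0 = 1
  · exact Or.inr (Or.inl h01)
  have hne : cnat π ≠ 0 := by
    intro h
    simp [h] at ho
  have h00 : π 0 ≠ 0 := fun h => hne (cnat_eq_zero_of_fixed h)
  have hb := one_lt_of_ne h00 h01
  have ha : 1 < π.symm 0 := by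
    apply one_lt_of_ne
    · rw [ne_eq, Equiv.symm_apply_eq]
      exact fun h => h00 h.symm
    · rw [ne_eq, Equiv.symm_apply_eq]
      exact fun h => h10 h.symm
  by_cases h11 : π 1 = 1
  · exact absurd (even_cnat ha hb h11) (Nat.not_even_iff_odd.2 ho)
  have h₁ := one_lt_of_ne h10 h11
  refine Or.inr (Or.inr ⟨?_, ?_, h₁⟩)
  · by_contra h
    refine absurd (four_le_cnat (two_lt_of_ne ha ?_) hb h₁ hne) (by omega)
    rw [ne_eq, Equiv.symm_apply_eq]
    exact fun h' => h h'.symm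
  · by_contra h
    have h₁' : 1 < π.symm 1 := by
      apply one_lt_of_ne
      · rw [ne_eq, Equiv.symm_apply_eq]
        exact fun h => h01 h.symm
      · rw [ne_eq, Equiv.symm_apply_eq]
        exact fun h => h11 h.symm
    have := four_le_cnat (π := π.symm) (two_lt_of_ne hb h) ha h₁' (by rwa [cnat_symm])
    rw [cnat_symm] at this
    omega

/-- The leftmost dot of row 1 lies under a dot of row 0, whose leaf is in column 2; columns 1 and 2
are excluded. -/
theorem one_zero_mem_of_notMem {T : Filling (m + 3) (m + 3)} (h : IsCnatOf π T) (h20 : π 2 = 0)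
    (h11 : (1, 1) ∉ T) : (1, 0) ∈ T := by
  obtain ⟨c, hc, -, h0⟩ := h.exists_leftmost_one
  have h2 := h.le_row _ _ h0
  rw [← h20, Equiv.symm_apply_apply] at h2
  rcases lt_or_eq_of_le h2 with h2 | rfl
  · rcases eq_zero_or_one_of_lt_two h2 with rfl | rfl
    · exact hc
    · exact absurd hc h11
  · have := h.le_col _ _ hc
    simp [h20] at this

theorem cornerFree_eq_empty (h20 : π 2 = 0) (h02 : π 0 = 2) : cornerFree π = ∅ := by
  rw [Set.eq_empty_iff_forall_notMem]
  rintro T ⟨h, h11, hno⟩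
  refine hno ⟨?_, one_zero_mem_of_notMem h h20 h11⟩
  have := one_zero_mem_of_notMem h.transpose (by rw [← h02, Equiv.symm_apply_apply]) (by simpa)
  simpa using this

/-- Three equinumerous classes remain. `cornerLeft` consists of the CNATs whose top row has dots in
columns 0 and 2 only, which `ncard_top_row` counts by `σ`. -/
theorem cnat_eq_three_mul {σ : Equiv.Perm (Fin (m + 2))} (hπ : π = insertPerm σ 2 0)
    (h02 : π 0 = 2) (h₁ : 1 < π 1) : cnat π = 3 * cnat σ := by
  have h20 : π 2 = 0 := by rw [hπ, insertPerm_self]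
  have ha : 1 < π.symm 0 := by
    rw [← h20, Equiv.symm_apply_apply]
    exact show (1 : ℕ) < 2 by omega
  have hb : 1 < π 0 := by
    rw [h02]
    exact show (1 : ℕ) < 2 by omega
  have hF := cornerFree_eq_empty h20 h02
  have hσ : cnat σ = (cornerLeft π).ncard := by
    rw [← ncard_top_row σ (a := 2) (Fin.pos_iff_ne_zero.1 (show (0 : ℕ) < 2 by omega)), ← hπ]
    congr 1
    ext T
    constructor
    · rintro ⟨h, htop⟩
      have h01 : (0, 1) ∉ T := by
        intro h'
        rcases htop 1 h' with h | h
        · simp at h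
        · exact absurd h (ne_of_lt (show (1 : ℕ) < 2 by omega))
      have h11 : (1, 1) ∈ T := by
        by_contra h11
        have hT : T ∈ cornerFree π := ⟨h, h11, fun h' => h01 h'.1⟩
        rw [hF] at hT
        exact hT
      exact ⟨h, h11, by_contra fun h10 => h01 ((h.corner h11).2 h10)⟩
    · rintro ⟨h, h11, h10⟩
      refine ⟨h, fun c hc => ?_⟩
      have h2 := h.le_row _ _ hc
      rw [← h20, Equiv.symm_apply_apply] at h2
      rcases lt_or_eq_of_le h2 with h2 | rfl
      · rcases eq_zero_or_one_of_lt_two h2 with rfl | rfl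
        · exact Or.inl rfl
        · exact absurd h10 ((h.corner h11).1 hc)
      · exact Or.inr rfl
  have e1 := ncard_cornerAbove_eq_cornerLeft ha hb
  have e2 := ncard_cornerAbove_eq_cornerBoth hb h₁
  rw [cnat_eq_corner, hF, ← e2, e1, hσ, Set.ncard_empty]
  ring

end Classification

/-! ### The recurrence and its solution -/

section Counting

theorem insertPerm_one_zero_apply_zero {m : ℕ} (σ : Equiv.Perm (Fin (m + 1))) (r : Fin (m + 2)) :
    insertPerm σ 1 r 0 = r.succAbove (σ 0) := by
  rw [← insertPerm_succAbove σ 1 r 0, succAbove_zero_of_ne (by simp)]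

theorem insertPerm_zero_apply_one {m : ℕ} (σ : Equiv.Perm (Fin (m + 1))) (r : Fin (m + 2)) :
    insertPerm σ 0 r 1 = r.succAbove (σ 0) := by
  rw [← insertPerm_succAbove σ 0 r 0]
  rfl

theorem insertPerm_two_apply_zero {m : ℕ} (σ : Equiv.Perm (Fin (m + 2))) (r : Fin (m + 3)) :
    insertPerm σ 2 r 0 = r.succAbove (σ 0) := by
  rw [← insertPerm_succAbove σ 2 r 0]
  rfl

theorem insertPerm_two_apply_one {m : ℕ} (σ : Equiv.Perm (Fin (m + 2))) (r : Fin (m + 3)) :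
    insertPerm σ 2 r 1 = r.succAbove (σ 1) := by
  rw [← insertPerm_succAbove σ 2 r 1]
  congr 1

/-- Insertion of two adjacent vertices of degree two into the inversion graph. -/
def insertPair {m : ℕ} (τ : Equiv.Perm (Fin (m + 1))) : Equiv.Perm (Fin (m + 3)) :=
  insertPerm (insertPerm τ 0 1) 2 0

theorem insertPair_zero {m : ℕ} (τ : Equiv.Perm (Fin (m + 1))) : insertPair τ 0 = 2 := by
  rw [insertPair, insertPerm_two_apply_zero, insertPerm_self]
  rfl

theorem one_lt_insertPair_one {m : ℕ} {τ : Equiv.Perm (Fin (m + 1))} (h : τ 0 ≠ 0) :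
    1 < insertPair τ 1 := by
  rw [insertPair, insertPerm_two_apply_one, insertPerm_zero_apply_one]
  apply one_lt_of_ne
  · exact Fin.succ_ne_zero _
  · rw [Fin.succAbove_zero]
    intro e
    have e' := Fin.succ_injective _ (e.trans Fin.succ_zero_eq_one.symm)
    exact h ((Fin.succAbove_eq_zero_iff (by simp)).1 e')

theorem cnat_insertPair {m : ℕ} {τ : Equiv.Perm (Fin (m + 1))} (h : τ 0 ≠ 0) :
    cnat (insertPair τ) = 3 * cnat τ := by
  rw [cnat_eq_three_mul (π := insertPair τ) rfl (insertPair_zero τ) (one_lt_insertPair_one h),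
    cnat_insertPerm_zero_one]

theorem insertPair_injective {m : ℕ} :
    Function.Injective (insertPair : Equiv.Perm (Fin (m + 1)) → _) := fun _ _ h =>
  insertPerm_injective 0 1 (insertPerm_injective 2 0 h)

theorem exists_eq_insertPair {m : ℕ} {π : Equiv.Perm (Fin (m + 3))} (h20 : π 2 = 0)
    (h02 : π 0 = 2) (h₁ : 1 < π 1) : ∃ τ, τ 0 ≠ 0 ∧ insertPair τ = π := by
  obtain ⟨σ, hσ⟩ := exists_eq_insertPerm 2 π
  rw [h20] at hσ
  have hσ0 : σ 0 = 1 := by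
    rw [hσ, insertPerm_two_apply_zero, Fin.succAbove_zero] at h02
    exact Fin.succ_injective _ h02
  obtain ⟨τ, hτ⟩ := exists_eq_insertPerm 0 σ
  rw [hσ0] at hτ
  refine ⟨τ, ?_, by rw [insertPair, ← hτ, ← hσ]⟩
  intro h0
  rw [hσ, insertPerm_two_apply_one, hτ, insertPerm_zero_apply_one, h0,
    succAbove_zero_of_ne (by simp)] at h₁
  exact h₁.ne rfl

theorem B_eq_union {m k : ℕ} (ho : Odd k) (hk : k < 4) :
    B (m + 3) k = ((fun σ => insertPerm σ 1 0) '' B (m + 2) k ∪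
      (fun σ => insertPerm σ 0 1) '' B (m + 2) k) ∪
      insertPair '' {τ : Equiv.Perm (Fin (m + 1)) | τ 0 ≠ 0 ∧ 3 * cnat τ = k} := by
  ext π
  constructor
  · rintro (h : cnat π = k)
    rcases of_odd_cnat_lt_four (by rwa [h]) (by rwa [h]) with h' | h' | ⟨h1, h2, h3⟩
    · obtain ⟨σ, hσ⟩ := exists_eq_insertPerm 1 π
      rw [h'] at hσ
      refine Or.inl (Or.inl ⟨σ, ?_, hσ.symm⟩)
      rwa [hσ, cnat_insertPerm_one_zero] at h
    · obtain ⟨σ, hσ⟩ := exists_eq_insertPerm 0 π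
      rw [h'] at hσ
      refine Or.inl (Or.inr ⟨σ, ?_, hσ.symm⟩)
      rwa [hσ, cnat_insertPerm_zero_one] at h
    · obtain ⟨τ, h0, rfl⟩ := exists_eq_insertPair h1 h2 h3
      exact Or.inr ⟨τ, ⟨h0, by rw [← h, cnat_insertPair h0]⟩, rfl⟩
  · rintro ((⟨σ, h, rfl⟩ | ⟨σ, h, rfl⟩) | ⟨τ, ⟨h0, h⟩, rfl⟩)
    · exact (cnat_insertPerm_one_zero σ).trans h
    · exact (cnat_insertPerm_zero_one σ).trans h
    · exact (cnat_insertPair h0).trans h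

theorem b_add_three {m k : ℕ} (ho : Odd k) (hk : k < 4) :
    b (m + 3) k = 2 * b (m + 2) k +
      {τ : Equiv.Perm (Fin (m + 1)) | τ 0 ≠ 0 ∧ 3 * cnat τ = k}.ncard := by
  rw [b, B_eq_union ho hk, Set.ncard_union_eq, Set.ncard_union_eq,
    Set.ncard_image_of_injective _ (insertPerm_injective 1 0),
    Set.ncard_image_of_injective _ (insertPerm_injective 0 1),
    Set.ncard_image_of_injective _ insertPair_injective, b]
  · ring
  · rw [Set.disjoint_left]
    rintro _ ⟨σ, h, rfl⟩ ⟨σ', -, h'⟩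
    -- A common element would give `σ 0 = 0`, hence count 0, which is not odd.
    have h0 := DFunLike.congr_fun h' 0
    simp only [insertPerm_self, insertPerm_one_zero_apply_zero] at h0
    rw [Fin.succAbove_zero, ← Fin.succ_zero_eq_one, Fin.succ_inj] at h0
    have hc : cnat σ = k := h
    rw [cnat_eq_zero_of_fixed h0.symm] at hc
    simp [← hc] at ho
  · rw [Set.disjoint_left]
    rintro _ h ⟨τ, ⟨h0, -⟩, rfl⟩
    have h1 := one_lt_insertPair_one h0
    have h2 := insertPair_zero τ
    rcases h with ⟨σ, -, h⟩ | ⟨σ, -, h⟩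
    · rw [← h] at h1
      simp at h1
    · rw [← h] at h2
      simp only [insertPerm_self] at h2
      exact absurd h2 (ne_of_lt (show (1 : ℕ) < 2 by omega))

theorem cnat_fin_one (π : Equiv.Perm (Fin 1)) : cnat π = 1 := by
  have sub : ∀ x y : Fin (0 + 1), x = y := Subsingleton.elim (α := Fin 1)
  rw [cnat_eq_ncard (m := 0), Set.ncard_eq_one]
  refine ⟨{(0, 0)}, ?_⟩
  ext T
  constructor
  · intro (h : IsCnatOf (m := 0) π T)
    have := h.root_mem
    refine Finset.ext fun d => ?_
    rw [(Prod.ext (sub d.1 0) (sub d.2 0) : d = (0, 0))]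
    simpa using this
  · rintro rfl
    constructor
    · intro c
      rw [sub (π c) 0, sub c 0]
      simp
    · intro r c _
      exact (sub _ _).le
    · intro r c _
      exact (sub _ _).le
    · intro r c _ h
      exact absurd ⟨sub _ _, sub _ _⟩ h

theorem B_two {k : ℕ} (hk : k ≠ 0) :
    B 2 k = (fun σ => insertPerm σ 0 1) '' {_σ : Equiv.Perm (Fin 1) | k = 1} := by
  ext π
  constructor
  · intro (h : cnat π = k)
    have h0 : π 0 ≠ 0 := by
      intro h0
      exact hk (h.symm.trans (cnat_eq_zero_of_fixed (m := 0) h0))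
    obtain ⟨σ, hσ⟩ := exists_eq_insertPerm 0 π
    rw [Fin.eq_one_of_ne_zero _ h0] at hσ
    refine ⟨σ, ?_, hσ.symm⟩
    rw [hσ, cnat_insertPerm_zero_one (m := 0), cnat_fin_one] at h
    exact h.symm
  · rintro ⟨σ, h, rfl⟩
    exact (cnat_insertPerm_zero_one (m := 0) σ).trans ((cnat_fin_one σ).trans h.symm)

theorem b_one (m : ℕ) : b (m + 2) 1 = 2 ^ m := by
  induction m with
  | zero =>
    rw [b, zero_add, B_two one_ne_zero, Set.ncard_image_of_injective _ (insertPerm_injective 0 1)]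
    simp [Set.ncard_univ]
  | succ m ih =>
    have : {τ : Equiv.Perm (Fin (m + 1)) | τ 0 ≠ 0 ∧ 3 * cnat τ = 1} = ∅ := by
      rw [Set.eq_empty_iff_forall_notMem]
      rintro τ ⟨-, h⟩
      omega
    rw [b_add_three odd_one (by omega), ih, this, Set.ncard_empty]
    ring

/-- The factor 2 avoids the exponent `m - 1`, which is negative for `m = 0`. -/
theorem two_mul_b_three (m : ℕ) : 2 * b (m + 3) 3 = m * 2 ^ m := by
  induction m with
  | zero =>
    have h : {τ : Equiv.Perm (Fin (0 + 1)) | τ 0 ≠ 0 ∧ 3 * cnat τ = 3} = ∅ := by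
      rw [Set.eq_empty_iff_forall_notMem]
      rintro τ ⟨h, -⟩
      exact h (Subsingleton.elim (α := Fin 1) _ _)
    rw [b_add_three (by decide) (by omega), h, b, zero_add, B_two (by omega)]
    simp
  | succ m ih =>
    -- In size at least 2, `τ 0 ≠ 0` follows from a nonzero count; in size 1 it fails, which makes
    -- the base case 0.
    have h : {τ : Equiv.Perm (Fin (m + 1 + 1)) | τ 0 ≠ 0 ∧ 3 * cnat τ = 3} = B (m + 2) 1 := by
      ext τ
      constructor
      · rintro ⟨-, h⟩
        exact (by omega : cnat τ = 1)
      · intro (h : cnat τ = 1)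
        refine ⟨fun h0 => ?_, by rw [h]⟩
        rw [cnat_eq_zero_of_fixed h0] at h
        omega
    have e : b (m + 1 + 3) 3 = 2 * b (m + 3) 3 + b (m + 2) 1 := by
      rw [b_add_three (by decide) (by omega), h]
      rfl
    rw [e, ih, b_one]
    ring

end Counting

end CNAT

theorem mainTheorem8 (n : ℕ) (hn : 3 ≤ n) :
    (CNAT.b n 3 : ℚ) = ((n : ℚ) - 3) * (2 : ℚ) ^ ((n : ℤ) - 4) := by
  obtain ⟨m, rfl⟩ := Nat.exists_eq_add_of_le' hn
  have h : (2 : ℚ) * CNAT.b (m + 3) 3 = m * 2 ^ m := by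
    exact_mod_cast CNAT.two_mul_b_three m
  have e : ((m + 3 : ℕ) : ℤ) - 4 = (m : ℤ) - 1 := by
    push_cast
    ring
  rw [e, zpow_sub_one₀ two_ne_zero, zpow_natCast]
  push_cast
  linarith
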